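/- Let $1\le k\le n$, let $a_1,\dots,a_n\in\mathbb R^k$, and let $A$ be the $k\times n$ matrix with columns $a_1,\dots,a_n$. Let $K\subset\mathbb R^n$ be Barthe's polytope: the convex hull of the vectors $\mathbf 1_J\in\{0,1\}^n$ over all index sets $J\subset\{1,\dots,n\}$ for which $(a_j)_{j\in J}$ is a basis of $\mathbb R^k$. Let $1\le p_j<\infty$ with $\sum_{j=1}^n 1/p_j=k$, suppose that $(1/p_1,\dots,1/p_n)$ lies in the relative interior of $K$ (the interior of $K$ in its affine hull), and let $B(\mathbf y)=\prod_{j=1}^n y_j^{1/p_j}$ on $\mathbb R^n_+=\{\mathbf y: y_j\ge 0 \text{ for all } j\}$. Write $\bullet$ for the Hadamard (entrywise) product, and $M\le N$ for symmetric matrices when $N-M$ is positive semidefinite. Then: 1. There is a real $k\times k$ matrix $C$ with $\langle Ca_j,a_j\rangle>0$ for all $j$ such that $A\,\mathrm{diag}\{1/(p_i\langle Ca_i,a_i\rangle)\}A^*$ is invertible and $$C=\Big(A\,\mathrm{diag}\Big\{\frac1{p_i\langle Ca_i,a_i\rangle}\Big\}A^*\Big)^{-1}.$$ 2. Every such $C$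 is symmetric and satisfies $(A^*CA)\bullet\mathrm{Hess}\,B(\mathbf y)\le 0$ for all $\mathbf y\in\mathrm{int}(\mathbb R^n_+)$, that is, $C$ is a matrix as required in L3 below. 3. For every symmetric $C$ with $\langle Ca_j,a_j\rangle>0$ for all $j$, put $S=\mathrm{diag}\{s_j\}$, $s_j=(p_j\langle Ca_j,a_j\rangle)^{-1/2}$. Then, for each $\mathbf y\in\mathrm{int}(\mathbb R^n_+)$, the inequality $(A^*CA)\bullet\mathrm{Hess}\,B(\mathbf y)\le0$ is equivalent to $(AS)^*C(AS)\le I_{n\times n}$. If $C$ is as in 1, then $(AS)^*C(AS)$ is the orthogonal projection of $\mathbb R^n$ onto the span of the columns of $SA^*$. 4. $B$ satisfies the following five properties. - L1: $B\in C(\mathbb R^n_+)\cap C^2(\mathrm{int}(\mathbb R^n_+))$. - L2: $B(\lambda\mathbf y)=\lambda^kB(\mathbf y)$ for all $\lambda\ge0$ and $\mathbf y\in\mathbb R^n_+$. - L3: there is a symmetric $k\times k$ matrix $C$ such that $(A^*CA)\bullet\mathrm{Hess}\,B(\mathbf y)\le0$ for all $\mathbf y\in\mathrm{int}(\mathbb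 R^n_+)$, and $\langle Ca_j,a_j\rangle>0$ for all $j$. - L4: $B\ge0$ on $\mathbb R^n_+$ and $B$ is not identically $0$. - L5: $\int_{\mathbb R^k}B\big(e^{-\langle a_1,x\rangle^2},\dots,e^{-\langle a_n,x\rangle^2}\big)\,dx<\infty$. -/

import Mathlib

open scoped Matrix

namespace BrascampLieb

noncomputable section

/-- The closed orthant of vectors in `ℝⁿ` with nonnegative coordinates. -/
def orthant (n : ℕ) : Set (Fin n → ℝ) := {y | ∀ j, 0 ≤ y j}

/-- The `k × n` matrix `A` whose columns are the vectors `a₁, …, aₙ` of `ℝᵏ`. -/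
def colMatrix {n k : ℕ} (a : Fin n → Fin k → ℝ) : Matrix (Fin k) (Fin n) ℝ :=
  Matrix.of fun i j => a j i

/-- The number `⟨C v, v⟩`. -/
def quadForm {k : ℕ} (C : Matrix (Fin k) (Fin k) ℝ) (v : Fin k → ℝ) : ℝ :=
  (C *ᵥ v) ⬝ᵥ v

/-- The Hessian matrix of second partial derivatives of `B` at `y`. -/
def hess {n : ℕ} (B : (Fin n → ℝ) → ℝ) (y : Fin n → ℝ) : Matrix (Fin n) (Fin n) ℝ :=
  Matrix.of fun i j =>
    fderiv ℝ (fun z => fderiv ℝ B z (Pi.single j 1)) y (Pi.single i 1)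

/-- The matrix inequality `(A* C A) • Hess B(y) ≤ 0`, with `•` the Hadamard product. -/
def HadamardHessNonpos {n k : ℕ} (a : Fin n → Fin k → ℝ) (B : (Fin n → ℝ) → ℝ)
    (C : Matrix (Fin k) (Fin k) ℝ) (y : Fin n → ℝ) : Prop :=
  (-(((colMatrix a)ᵀ * C * colMatrix a) ⊙ hess B y)).PosSemidef

/-- L1: `B` is continuous on the closed orthant and `C²` in its interior. -/
def L1 {n : ℕ} (B : (Fin n → ℝ) → ℝ) : Prop :=
  ContinuousOn B (orthant n) ∧ ContDiffOn ℝ 2 B (interior (orthant n))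

/-- L2: `B` is homogeneous of degree `k` on the orthant. -/
def L2 {n : ℕ} (k : ℕ) (B : (Fin n → ℝ) → ℝ) : Prop :=
  ∀ t : ℝ, 0 ≤ t → ∀ y ∈ orthant n, B (t • y) = t ^ k * B y

/-- The matrix `C` is a witness for L3. -/
def IsL3Matrix {n k : ℕ} (a : Fin n → Fin k → ℝ) (B : (Fin n → ℝ) → ℝ)
    (C : Matrix (Fin k) (Fin k) ℝ) : Prop :=
  C.IsSymm ∧ (∀ y ∈ interior (orthant n), HadamardHessNonpos a B C y) ∧
    ∀ j, 0 < quadForm C (a j)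

/-- L3: the concavity condition. -/
def L3 {n k : ℕ} (a : Fin n → Fin k → ℝ) (B : (Fin n → ℝ) → ℝ) : Prop :=
  ∃ C : Matrix (Fin k) (Fin k) ℝ, IsL3Matrix a B C

/-- L4: `B` is nonnegative and not identically zero on the orthant. -/
def L4 {n : ℕ} (B : (Fin n → ℝ) → ℝ) : Prop :=
  (∀ y ∈ orthant n, 0 ≤ B y) ∧ ∃ y ∈ orthant n, B y ≠ 0

/-- L5: `x ↦ B (exp (-⟨a₁, x⟩²), …, exp (-⟨aₙ, x⟩²))` has a finite Lebesgue integral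
over `ℝᵏ`. -/
def L5 {n k : ℕ} (a : Fin n → Fin k → ℝ) (B : (Fin n → ℝ) → ℝ) : Prop :=
  MeasureTheory.Integrable
    (fun x : Fin k → ℝ => B fun j => Real.exp (-(a j ⬝ᵥ x) ^ 2)) MeasureTheory.volume

/-- The Young function `B(y) = ∏ yⱼ ^ (1 / pⱼ)`. -/
def youngFunction {n : ℕ} (p : Fin n → ℝ) (y : Fin n → ℝ) : ℝ :=
  ∏ j, y j ^ (1 / p j)

/-- Barthe's polytope `K`: the convex hull of the 0-1 indicator vectors of the index sets `J`
such that `(aⱼ)`, `j ∈ J`, is a basis of `ℝᵏ`. -/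
def barthePolytope {n k : ℕ} (a : Fin n → Fin k → ℝ) : Set (Fin n → ℝ) :=
  convexHull ℝ {v | ∃ J : Finset (Fin n),
    LinearIndependent ℝ (fun j : J => a j) ∧ Submodule.span ℝ (a '' (J : Set (Fin n))) = ⊤ ∧
      v = fun j => if j ∈ J then 1 else 0}

/-- `A diag{1 / (pᵢ ⟨C aᵢ, aᵢ⟩)} A*`. -/
def youngGram {n k : ℕ} (a : Fin n → Fin k → ℝ) (p : Fin n → ℝ)
    (C : Matrix (Fin k) (Fin k) ℝ) : Matrix (Fin k) (Fin k) ℝ :=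
  colMatrix a * Matrix.diagonal (fun i => 1 / (p i * quadForm C (a i))) * (colMatrix a)ᵀ

/-- `C` solves `C = (A diag{1 / (pᵢ ⟨C aᵢ, aᵢ⟩)} A*)⁻¹`, where all the `⟨C aᵢ, aᵢ⟩` are positive
and the inverted matrix is invertible. -/
def IsYoungMatrix {n k : ℕ} (a : Fin n → Fin k → ℝ) (p : Fin n → ℝ)
    (C : Matrix (Fin k) (Fin k) ℝ) : Prop :=
  (∀ j, 0 < quadForm C (a j)) ∧ IsUnit (youngGram a p C) ∧ C = (youngGram a p C)⁻¹

/-- The diagonal matrix `S` with entries `sⱼ > 0`, `sⱼ² = 1 / (pⱼ ⟨C aⱼ, aⱼ⟩)`. -/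
def scaling {n k : ℕ} (a : Fin n → Fin k → ℝ) (p : Fin n → ℝ)
    (C : Matrix (Fin k) (Fin k) ℝ) : Matrix (Fin n) (Fin n) ℝ :=
  Matrix.diagonal fun j => Real.sqrt (1 / (p j * quadForm C (a j)))

/-- The matrix `(A S)* C (A S)`. -/
def scaledGram {n k : ℕ} (a : Fin n → Fin k → ℝ) (p : Fin n → ℝ)
    (C : Matrix (Fin k) (Fin k) ℝ) : Matrix (Fin n) (Fin n) ℝ :=
  (colMatrix a * scaling a p C)ᵀ * C * (colMatrix a * scaling a p C)

/-- `P` is the matrix of the orthogonal projection of Euclidean `ℝⁿ` onto the subspace `V`: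
it is symmetric and idempotent, with range `V`. -/
def IsOrthogonalProjectionOnto {n : ℕ} (P : Matrix (Fin n) (Fin n) ℝ)
    (V : Submodule ℝ (Fin n → ℝ)) : Prop :=
  P.IsSymm ∧ P * P = P ∧ LinearMap.range P.mulVecLin = V

end

end BrascampLieb

namespace BrascampLieb

/-! Write c = (1/p_j) and Q(t) = A diag(e^{t_j}) A*. A matrix C as required comes from a minimum of
det Q(t) e^{-⟨c,t⟩}: stationarity in t_j reads e^{t_j}⟨Q⁻¹a_j, a_j⟩ = 1/p_j, so C = Q⁻¹ satisfies
1/(p_j⟨Ca_j, a_j⟩) = e^{t_j}, which is the fixed-point equation (`exists_isYoungMatrix`).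

The minimum exists because Cauchy–Binet (`factorial_mul_det_colMatrix`) writes the function as a
positive combination of e^{⟨1_J - c, t⟩} over bases J. As c is in the relative interior of K, the
vectors 1_J - c satisfy a relation with strictly positive coefficients, so the exponents cannot all
be ≤ 0 unless all vanish. Sublevel sets are therefore bounded in the space of exponents
(`exists_forall_sum_exp_le`).

The Hessian of a product of powers is a rank-one matrix minus a diagonal one. Hence the L3
inequality is, up to a positive diagonal congruence, (AS)*C(AS) ≤ I, for every y at once. For the C
above, (AS)(AS)* = C⁻¹, so (AS)*C(AS) is an orthogonal projection and the inequality holds. -/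

/-- A positive combination of exponentials of linear forms satisfying a relation with positive
coefficients attains its minimum. -/
theorem exists_forall_sum_exp_le {ι E : Type*} [Fintype ι] [AddCommGroup E] [Module ℝ E]
    (L : E →ₗ[ℝ] (ι → ℝ)) (b w : ι → ℝ) (hb : ∀ i, 0 < b i) (hw : ∀ i, 0 < w i)
    (h : ∀ t, ∑ i, w i * L t i = 0) :
    ∃ t₀, ∀ t, ∑ i, b i * Real.exp (L t₀ i) ≤ ∑ i, b i * Real.exp (L t i) := by
  classical
  set Φ : (ι → ℝ) → ℝ := fun s => ∑ i, b i * Real.exp (s i) with hΦ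
  have hterm : ∀ s i, b i * Real.exp (s i) ≤ Φ s := fun s i =>
    Finset.single_le_sum (f := fun i => b i * Real.exp (s i))
      (fun j _ => (mul_pos (hb j) (Real.exp_pos _)).le) (Finset.mem_univ i)
  -- On the sublevel set of `Φ 0` each single term is at most `Φ 0`, which bounds every exponent
  -- above by `M`.
  set M : ι → ℝ := fun i => Real.log (Φ 0 / b i) with hM
  have hM0 : ∀ i, 0 ≤ M i := fun i => Real.log_nonneg (by
    rw [le_div_iff₀ (hb i)]; simpa using hterm 0 i)
  have hle : ∀ s, Φ s ≤ Φ 0 → ∀ i, s i ≤ M i := fun s hs i => by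
    have h0 : Real.exp (s i) ≤ Φ 0 / b i := by
      rw [le_div_iff₀ (hb i), mul_comm]; exact (hterm s i).trans hs
    exact (Real.le_log_iff_exp_le ((Real.exp_pos _).trans_le h0)).2 h0
  -- The relation expresses `w i * L t i` as minus the sum of the others, so the upper bounds yield
  -- lower bounds.
  set N : ι → ℝ := fun i => -(∑ j, w j * M j) / w i with hN
  have hge : ∀ t, Φ (L t) ≤ Φ 0 → ∀ i, N i ≤ L t i := fun t ht i => by
    rw [hN, div_le_iff₀ (hw i)]
    have h1 := h t
    rw [← Finset.add_sum_erase _ _ (Finset.mem_univ i)] at h1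
    have h2 : ∑ j ∈ Finset.univ.erase i, w j * L t j ≤ ∑ j, w j * M j :=
      (Finset.sum_le_sum fun j _ => mul_le_mul_of_nonneg_left (hle _ ht j) (hw j).le).trans
        (Finset.sum_le_sum_of_subset_of_nonneg (Finset.erase_subset _ _)
          fun j _ _ => mul_nonneg (hw j).le (hM0 j))
    linarith
  have hcont : Continuous Φ := by fun_prop
  -- Minimising over the range of `L` instead of over `t` avoids the kernel of `L`, along which
  -- there is no compactness.
  have hcomp : IsCompact (Set.Icc N M ∩ (LinearMap.range L : Set (ι → ℝ))) :=
    isCompact_Icc.inter_right (Submodule.closed_of_finiteDimensional _)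
  have h0mem : (0 : ι → ℝ) ∈ Set.Icc N M ∩ (LinearMap.range L : Set (ι → ℝ)) := by
    refine ⟨⟨fun i => ?_, fun i => hM0 i⟩, zero_mem _⟩
    simpa using hge 0 (by simp) i
  obtain ⟨s, ⟨-, t₀, rfl⟩, hmin⟩ := hcomp.exists_isMinOn ⟨0, h0mem⟩ hcont.continuousOn
  refine ⟨t₀, fun t => ?_⟩
  by_cases ht : Φ (L t) ≤ Φ 0
  · exact hmin ⟨⟨hge t ht, hle _ ht⟩, t, rfl⟩
  · exact (hmin h0mem).trans (not_le.1 ht).le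

/-! ### Cauchy–Binet -/

/-- A form of the Cauchy–Binet formula for `A diag(x) A*`, summed over all maps instead of
subsets. -/
theorem factorial_mul_det_colMatrix {n k : ℕ} (a : Fin n → Fin k → ℝ) (x : Fin n → ℝ) :
    (k.factorial : ℝ) * (colMatrix a * Matrix.diagonal x * (colMatrix a)ᵀ).det =
      ∑ f : Fin k → Fin n, (Matrix.of fun i => a (f i)).det ^ 2 * ∏ i, x (f i) := by
  have h1 : (colMatrix a * Matrix.diagonal x * (colMatrix a)ᵀ).det =
      ∑ f : Fin k → Fin n, (∏ i, x (f i)) * (∏ i, a (f i) i) *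
        (Matrix.of fun i => a (f i)).det := by
    -- Each row is a combination of the vectors `a j`; multilinearity of the determinant then gives
    -- a sum over maps `f`.
    have hrow : colMatrix a * Matrix.diagonal x * (colMatrix a)ᵀ =
        fun i => ∑ j, (x j * a j i) • a j := by
      ext i l
      rw [Matrix.mul_apply, Finset.sum_apply]
      simp only [colMatrix, Matrix.mul_diagonal, Matrix.of_apply,
        Matrix.transpose_apply, Pi.smul_apply, smul_eq_mul]
      exact Finset.sum_congr rfl fun j _ => by ring
    rw [hrow]
    have := (Matrix.detRowAlternating (R := ℝ) (n := Fin k)).toMultilinearMap.map_sum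
      (fun i (j : Fin n) => (x j * a j i) • a j)
    refine this.trans (Finset.sum_congr rfl fun f _ => ?_)
    refine ((Matrix.detRowAlternating (R := ℝ) (n := Fin k)).toMultilinearMap.map_smul_univ
      (fun i => x (f i) * a (f i) i) (fun i => a (f i))).trans ?_
    rw [Finset.prod_mul_distrib]
    rfl
  -- Replacing `f` by `f ∘ σ` brings out `sign σ`. Summed over `σ`, the products of entries
  -- reassemble a second copy of the determinant by the Leibniz formula; this is the source of `k!`.
  have h2 : ∀ σ : Equiv.Perm (Fin k), (colMatrix a * Matrix.diagonal x * (colMatrix a)ᵀ).det =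
      ∑ f : Fin k → Fin n, (∏ i, x (f i)) * (∏ i, a (f (σ i)) i) *
        (((Equiv.Perm.sign σ : ℤ) : ℝ) * (Matrix.of fun i => a (f i)).det) := fun σ => by
    rw [h1, ← Equiv.sum_comp (σ.symm.arrowCongr (Equiv.refl (Fin n)))]
    refine Finset.sum_congr rfl fun f _ => ?_
    have h3 := Matrix.det_permute σ (Matrix.of fun i => a (f i))
    have h4 : ∏ i, x (f (σ i)) = ∏ i, x (f i) := Equiv.prod_comp σ fun i => x (f i)
    rw [← h3, ← h4]
    rfl
  have h5 : ∑ σ : Equiv.Perm (Fin k), (colMatrix a * Matrix.diagonal x * (colMatrix a)ᵀ).det =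
      (k.factorial : ℝ) * (colMatrix a * Matrix.diagonal x * (colMatrix a)ᵀ).det := by
    rw [Finset.sum_const, Finset.card_univ, Fintype.card_perm, Fintype.card_fin, nsmul_eq_mul]
  rw [← h5, Finset.sum_congr rfl fun σ _ => h2 σ, Finset.sum_comm]
  refine Finset.sum_congr rfl fun f _ => ?_
  rw [pow_two]
  conv_rhs => arg 1; arg 2; rw [Matrix.det_apply']
  rw [Finset.mul_sum, Finset.sum_mul]
  refine Finset.sum_congr rfl fun σ _ => ?_
  simp only [Matrix.of_apply]
  ring

/-! ### Relative interior and Barthe's polytope -/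

/-- From a point of the relative interior of `s` one can move a little away from any point of the
affine span without leaving `s`. -/
theorem exists_lineMap_neg_mem_of_mem_intrinsicInterior {E : Type*} [NormedAddCommGroup E]
    [NormedSpace ℝ E] {s : Set E} {x v : E} (hx : x ∈ intrinsicInterior ℝ s)
    (hv : v ∈ affineSpan ℝ s) : ∃ ε > 0, AffineMap.lineMap x v (-ε : ℝ) ∈ s := by
  obtain ⟨y, hy, rfl⟩ := mem_intrinsicInterior.1 hx
  have hmem : ∀ r : ℝ, AffineMap.lineMap (y : E) v r ∈ affineSpan ℝ s := fun r =>
    AffineMap.lineMap_mem r y.2 hv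
  let φ : ℝ → affineSpan ℝ s := fun r => ⟨AffineMap.lineMap (y : E) v r, hmem r⟩
  have hφ : Continuous φ := by
    refine Continuous.subtype_mk ?_ _
    exact AffineMap.lineMap_continuous
  have h0 : φ 0 = y := Subtype.ext (by simp [φ])
  have hnhds : φ ⁻¹' ((↑) ⁻¹' s) ∈ nhds (0 : ℝ) :=
    hφ.continuousAt.preimage_mem_nhds (by rw [h0]; exact mem_interior_iff_mem_nhds.1 hy)
  obtain ⟨δ, hδ, hball⟩ := Metric.mem_nhds_iff.1 hnhds
  refine ⟨δ / 2, half_pos hδ, hball (?_ : -(δ / 2) ∈ Metric.ball (0 : ℝ) δ)⟩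
  rw [Metric.mem_ball, dist_zero_right, norm_neg, Real.norm_of_nonneg (half_pos hδ).le]
  exact half_lt_self hδ

/-- A point of the relative interior of a polytope satisfies a linear relation with positive
coefficients among the differences to the vertices. -/
theorem exists_pos_relation_of_mem_intrinsicInterior {ι E : Type*} [Fintype ι]
    [NormedAddCommGroup E] [NormedSpace ℝ E] {v : ι → E} {x : E}
    (hx : x ∈ intrinsicInterior ℝ (convexHull ℝ (Set.range v))) :
    ∃ w : ι → ℝ, (∀ i, 0 < w i) ∧ ∑ i, w i • (v i - x) = 0 := by
  classical
  -- The point (1+ε)x - εv_i is still a convex combination ∑ u_j v_j, so ∑ u_j(v_j - x) + ε(v_i - x)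
  -- = 0 with positive i-th coefficient. Adding these relations over i makes all coefficients
  -- positive.
  have key : ∀ i, ∃ u : ι → ℝ, (∀ j, 0 ≤ u j) ∧ 0 < u i ∧ ∑ j, u j • (v j - x) = 0 := fun i => by
    obtain ⟨ε, hε, hmem⟩ := exists_lineMap_neg_mem_of_mem_intrinsicInterior hx
      (subset_affineSpan ℝ _ (subset_convexHull ℝ _ (Set.mem_range_self i)))
    obtain ⟨s, u, hu, hu1, hux⟩ : ∃ (s : Finset ι) (u : ι → ℝ), (∀ j ∈ s, 0 ≤ u j) ∧
        s.sum u = 1 ∧ s.affineCombination ℝ v u = AffineMap.lineMap x (v i) (-ε) := by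
      rwa [convexHull_range_eq_exists_affineCombination] at hmem
    rw [Finset.affineCombination_eq_linear_combination _ _ _ hu1] at hux
    have hu' : ∀ j, 0 ≤ if j ∈ s then u j else 0 := fun j => by
      split_ifs with h
      exacts [hu j h, le_rfl]
    refine ⟨fun j => (if j ∈ s then u j else 0) + if j = i then ε else 0,
      fun j => add_nonneg (hu' j) (by split_ifs <;> simp [hε.le]),
      add_pos_of_nonneg_of_pos (hu' i) (by simpa using hε), ?_⟩
    simp only [add_smul, Finset.sum_add_distrib, ite_smul, zero_smul, Finset.sum_ite_mem,
      Finset.univ_inter, Finset.sum_ite_eq', Finset.mem_univ, if_true, smul_sub,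
      Finset.sum_sub_distrib]
    rw [hux, ← Finset.sum_smul, hu1, AffineMap.lineMap_apply_module']
    module
  choose u hu hpos hrel using key
  refine ⟨fun j => ∑ i, u i j, fun j => Finset.sum_pos' (fun i _ => hu i j)
    ⟨j, Finset.mem_univ j, hpos j⟩, ?_⟩
  simp only [Finset.sum_smul]
  rw [Finset.sum_comm]
  exact Finset.sum_eq_zero fun i _ => hrel i

/-- Indexing the vertices by maps that enumerate a basis matches the Cauchy–Binet sum; the resulting
repetitions do not change the hull. -/
theorem barthePolytope_eq {n k : ℕ} (a : Fin n → Fin k → ℝ) :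
    barthePolytope a = convexHull ℝ (Set.range
      fun f : {f : Fin k → Fin n // LinearIndependent ℝ fun i => a (f i)} =>
        fun j => if j ∈ Finset.univ.image f.1 then (1 : ℝ) else 0) := by
  classical
  refine congrArg (convexHull ℝ) (Set.ext fun v => ⟨?_, ?_⟩)
  · rintro ⟨J, hli, hspan, rfl⟩
    have hcard : Fintype.card J = k := by
      have hspan' : ⊤ ≤ Submodule.span ℝ (Set.range fun j : J => a j) := by
        rw [← hspan]
        refine Submodule.span_mono ?_
        rintro _ ⟨j, hj, rfl⟩
        exact ⟨⟨j, hj⟩, rfl⟩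
      have := Module.finrank_eq_card_basis (Module.Basis.mk hli hspan')
      simpa using this.symm
    let e : Fin k ≃ J := (Fintype.equivFinOfCardEq hcard).symm
    refine ⟨⟨fun i => (e i : Fin n), hli.comp e e.injective⟩, funext fun j => ?_⟩
    have : j ∈ Finset.univ.image (fun i => (e i : Fin n)) ↔ j ∈ J := by
      simp only [Finset.mem_image, Finset.mem_univ, true_and]
      exact ⟨fun ⟨i, hi⟩ => hi ▸ (e i).2, fun hj => ⟨e.symm ⟨j, hj⟩, by simp⟩⟩
    simp only [this]
  · rintro ⟨⟨f, hf⟩, rfl⟩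
    have himg : a '' ((Finset.univ.image f : Finset (Fin n)) : Set (Fin n)) =
        Set.range fun i => a (f i) := by
      rw [Finset.coe_image, Finset.coe_univ, Set.image_univ, ← Set.range_comp]; rfl
    refine ⟨Finset.univ.image f, ?_, ?_, rfl⟩
    · have h1 := hf.linearIndepOn_id
      have hinj : Set.InjOn a ((Finset.univ.image f : Finset (Fin n)) : Set (Fin n)) := by
        intro x hx y hy hxy
        simp only [Finset.coe_image, Finset.coe_univ, Set.image_univ, Set.mem_range] at hx hy
        obtain ⟨i, rfl⟩ := hx
        obtain ⟨l, rfl⟩ := hy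
        exact congrArg f (hf.injective hxy)
      rw [← himg] at h1
      exact (linearIndepOn_iff_image hinj).2 h1
    · rw [himg]
      exact hf.span_eq_top_of_card_eq_finrank' (by simp)

theorem det_ne_zero_iff_linearIndependent {n k : ℕ} (a : Fin n → Fin k → ℝ) (f : Fin k → Fin n) :
    (Matrix.of fun i => a (f i)).det ≠ 0 ↔ LinearIndependent ℝ fun i => a (f i) := by
  rw [← isUnit_iff_ne_zero, ← Matrix.isUnit_iff_isUnit_det,
    ← Matrix.linearIndependent_rows_iff_isUnit]
  rfl

theorem sum_ite_mem_image_mul {n k : ℕ} {f : Fin k → Fin n} (hf : Function.Injective f)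
    (t : Fin n → ℝ) :
    ∑ j, (if j ∈ Finset.univ.image f then (1 : ℝ) else 0) * t j = ∑ i, t (f i) := by
  classical
  simp only [ite_mul, one_mul, zero_mul, Finset.sum_ite_mem, Finset.univ_inter]
  exact Finset.sum_image fun _ _ _ _ h => hf h

theorem exists_linearIndependent_of_mem_intrinsicInterior {n k : ℕ} {a : Fin n → Fin k → ℝ}
    {c : Fin n → ℝ} (hc : c ∈ intrinsicInterior ℝ (barthePolytope a)) :
    ∃ f : Fin k → Fin n, LinearIndependent ℝ fun i => a (f i) := by
  have h : (barthePolytope a).Nonempty := ⟨c, intrinsicInterior_subset hc⟩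
  rw [barthePolytope_eq, convexHull_nonempty_iff, Set.range_nonempty_iff_nonempty] at h
  exact h.elim fun f => ⟨f.1, f.2⟩

/-! ### The determinant functional and existence of C -/

/-- `A diag(x) A*` is invertible for positive `x` if the columns of `A` contain a basis. -/
theorem det_colMatrix_mul_diagonal_pos {n k : ℕ} {a : Fin n → Fin k → ℝ} {f : Fin k → Fin n}
    (hf : LinearIndependent ℝ fun i => a (f i)) {x : Fin n → ℝ} (hx : ∀ j, 0 < x j) :
    0 < (colMatrix a * Matrix.diagonal x * (colMatrix a)ᵀ).det := by
  have h : 0 < (k.factorial : ℝ) * (colMatrix a * Matrix.diagonal x * (colMatrix a)ᵀ).det := by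
    rw [factorial_mul_det_colMatrix]
    refine Finset.sum_pos' (fun g _ => mul_nonneg (sq_nonneg _)
      (Finset.prod_nonneg fun i _ => (hx _).le)) ⟨f, Finset.mem_univ f, ?_⟩
    have := (det_ne_zero_iff_linearIndependent a f).2 hf
    exact mul_pos (by positivity) (Finset.prod_pos fun i _ => hx _)
  exact pos_of_mul_pos_right h (by positivity)

/-- Changing one coordinate of `t` is a rank-one update, so the matrix determinant lemma gives the
exact dependence on `u`. This replaces differentiating a determinant. -/
theorem det_colMatrix_mul_diagonal_exp_add_single {n k : ℕ} (a : Fin n → Fin k → ℝ)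
    (t : Fin n → ℝ) (j : Fin n) (u : ℝ)
    (h : IsUnit (colMatrix a * Matrix.diagonal (fun i => Real.exp (t i)) * (colMatrix a)ᵀ).det) :
    (colMatrix a * Matrix.diagonal (fun i => Real.exp ((t + Pi.single j u : Fin n → ℝ) i)) *
        (colMatrix a)ᵀ).det =
      (colMatrix a * Matrix.diagonal (fun i => Real.exp (t i)) * (colMatrix a)ᵀ).det *
        (1 + (Real.exp u - 1) * Real.exp (t j) * quadForm
          (colMatrix a * Matrix.diagonal (fun i => Real.exp (t i)) * (colMatrix a)ᵀ)⁻¹ (a j)) := by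
  have hd : Matrix.diagonal (fun i => Real.exp ((t + Pi.single j u : Fin n → ℝ) i)) =
      Matrix.diagonal (fun i => Real.exp (t i)) +
        Matrix.diagonal (Pi.single j ((Real.exp u - 1) * Real.exp (t j))) := by
    rw [Matrix.diagonal_add]
    congr 1
    ext i
    by_cases hij : i = j
    · subst hij
      simp only [Pi.add_apply, Pi.single_eq_same, Real.exp_add]
      ring
    · simp [hij]
  have hv : colMatrix a * Matrix.diagonal (Pi.single j ((Real.exp u - 1) * Real.exp (t j))) *
      (colMatrix a)ᵀ = Matrix.replicateCol Unit (((Real.exp u - 1) * Real.exp (t j)) • a j) *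
        Matrix.replicateRow Unit (a j) := by
    ext i l
    rw [Matrix.mul_apply, Finset.sum_eq_single j]
    · rw [Matrix.mul_diagonal]
      simp [colMatrix, Matrix.mul_apply, mul_comm]
    · intro m _ hm
      rw [Matrix.mul_diagonal]
      simp [hm]
    · simp
  rw [hd, Matrix.mul_add, Matrix.add_mul, hv, Matrix.det_add_replicateCol_mul_replicateRow h]
  congr 2
  rw [Matrix.det_unique]
  simp only [Matrix.add_apply, Matrix.one_apply_eq, Matrix.mul_assoc, quadForm]
  congr 1
  rw [Matrix.mul_apply]
  simp only [Matrix.replicateRow_apply, dotProduct, Matrix.mul_apply, Matrix.replicateCol_apply,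
    Matrix.mulVec, Finset.mul_sum, Pi.smul_apply, smul_eq_mul]
  exact Finset.sum_congr rfl fun i _ => by
    rw [Finset.sum_mul, Finset.mul_sum]
    exact Finset.sum_congr rfl fun l _ => by ring

/-- The function `t ↦ det (A e^t A*) e^{-⟨c, t⟩}` attains its minimum when `c` lies in the
relative interior of Barthe's polytope. -/
theorem exists_forall_det_mul_exp_le {n k : ℕ} {a : Fin n → Fin k → ℝ} {c : Fin n → ℝ}
    (hc : c ∈ intrinsicInterior ℝ (barthePolytope a)) :
    ∃ t₀ : Fin n → ℝ, ∀ t : Fin n → ℝ,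
      (colMatrix a * Matrix.diagonal (fun i => Real.exp (t₀ i)) * (colMatrix a)ᵀ).det *
          Real.exp (-(c ⬝ᵥ t₀)) ≤
        (colMatrix a * Matrix.diagonal (fun i => Real.exp (t i)) * (colMatrix a)ᵀ).det *
          Real.exp (-(c ⬝ᵥ t)) := by
  classical
  rw [barthePolytope_eq] at hc
  obtain ⟨w, hw, hrel⟩ := exists_pos_relation_of_mem_intrinsicInterior hc
  -- The row 1_J - c produces the exponent of the Cauchy–Binet term for J after the factor
  -- e^{-⟨c,t⟩} is absorbed.
  let D : Matrix {f : Fin k → Fin n // LinearIndependent ℝ fun i => a (f i)} (Fin n) ℝ :=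
    Matrix.of fun f j => (if j ∈ Finset.univ.image f.1 then (1 : ℝ) else 0) - c j
  have hD : ∀ t f, D.mulVecLin t f = ∑ i, t (f.1 i) - c ⬝ᵥ t := fun t f => by
    rw [← sum_ite_mem_image_mul (f := f.1) (fun i l h => f.2.injective (congrArg a h))]
    simp only [D, Matrix.mulVecLin_apply, Matrix.mulVec, dotProduct, Matrix.of_apply, sub_mul,
      Finset.sum_sub_distrib]
  obtain ⟨t₀, ht₀⟩ := exists_forall_sum_exp_le D.mulVecLin
    (fun f => (Matrix.of fun i => a (f.1 i)).det ^ 2) w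
    (fun f => by have := (det_ne_zero_iff_linearIndependent a f.1).2 f.2; positivity) hw
    (fun t => by
      have : ∑ f, w f * D.mulVecLin t f = (∑ f, w f • D f) ⬝ᵥ t := by
        rw [sum_dotProduct]
        refine Finset.sum_congr rfl fun f _ => ?_
        rw [smul_dotProduct]; rfl
      rw [this]
      have h0 : ∑ f, w f • D f = 0 := hrel
      rw [h0, zero_dotProduct])
  have key : ∀ t : Fin n → ℝ, (k.factorial : ℝ) *
      ((colMatrix a * Matrix.diagonal (fun i => Real.exp (t i)) * (colMatrix a)ᵀ).det *
          Real.exp (-(c ⬝ᵥ t))) = ∑ f : {f : Fin k → Fin n // LinearIndependent ℝ fun i => a (f i)},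
        (Matrix.of fun i => a (f.1 i)).det ^ 2 * Real.exp (D.mulVecLin t f) := fun t => by
    have hterm : ∀ f : Fin k → Fin n, (Matrix.of fun i => a (f i)).det ^ 2 *
        Real.exp (∑ i, t (f i) - c ⬝ᵥ t) ≠ 0 → LinearIndependent ℝ fun i => a (f i) :=
      fun f h => (det_ne_zero_iff_linearIndependent a f).1 (ne_zero_pow two_ne_zero
        (left_ne_zero_of_mul h))
    simp only [hD]
    rw [← Finset.sum_subtype (Finset.univ.filter fun f : Fin k → Fin n =>
        LinearIndependent ℝ fun i => a (f i)) (by simp)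
        (fun f => (Matrix.of fun i => a (f i)).det ^ 2 * Real.exp (∑ i, t (f i) - c ⬝ᵥ t)),
      Finset.sum_filter_of_ne fun f _ => hterm f, ← mul_assoc, factorial_mul_det_colMatrix,
      Finset.sum_mul]
    refine Finset.sum_congr rfl fun f _ => ?_
    rw [sub_eq_add_neg, Real.exp_add, Real.exp_sum, mul_assoc]
  refine ⟨t₀, fun t => ?_⟩
  have h := ht₀ t
  rw [← key, ← key] at h
  exact le_of_mul_le_mul_left h (by positivity)

theorem exists_isYoungMatrix {n k : ℕ} {a : Fin n → Fin k → ℝ} {p : Fin n → ℝ}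
    (hp : ∀ j, 0 < p j)
    (hK : (fun j => 1 / p j) ∈ intrinsicInterior ℝ (barthePolytope a)) :
    ∃ C : Matrix (Fin k) (Fin k) ℝ, IsYoungMatrix a p C := by
  obtain ⟨f, hf⟩ := exists_linearIndependent_of_mem_intrinsicInterior hK
  obtain ⟨t, ht⟩ := exists_forall_det_mul_exp_le hK
  set Q := colMatrix a * Matrix.diagonal (fun i => Real.exp (t i)) * (colMatrix a)ᵀ with hQ
  have hdet : 0 < Q.det := det_colMatrix_mul_diagonal_pos hf fun j => Real.exp_pos _
  have hunit : IsUnit Q.det := hdet.ne'.isUnit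
  have hq : ∀ j, Real.exp (t j) * quadForm Q⁻¹ (a j) = 1 / p j := fun j => by
    set r := Real.exp (t j) * quadForm Q⁻¹ (a j) with hr
    -- The functional along coordinate `j`, divided by its value at the minimiser; its derivative at
    -- 0 must vanish.
    have hderiv : HasDerivAt (fun u : ℝ => (1 + (Real.exp u - 1) * r) * Real.exp (-(1 / p j * u)))
        (r - 1 / p j) 0 := by
      have h1 : HasDerivAt (fun u : ℝ => 1 + (Real.exp u - 1) * r) (Real.exp 0 * r) 0 :=
        (((Real.hasDerivAt_exp 0).sub_const 1).mul_const r).const_add 1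
      have h2 : HasDerivAt (fun u : ℝ => Real.exp (-(1 / p j * u)))
          (Real.exp (-(1 / p j * 0)) * -(1 / p j * 1)) 0 :=
        (((hasDerivAt_id (0 : ℝ)).const_mul (1 / p j)).neg).exp
      refine (h1.mul h2).congr_deriv ?_
      simp
      ring
    have hmin : IsLocalMin
        (fun u : ℝ => (1 + (Real.exp u - 1) * r) * Real.exp (-(1 / p j * u))) 0 := by
      refine Filter.Eventually.of_forall fun u => ?_
      have h := ht (t + Pi.single j u)
      rw [det_colMatrix_mul_diagonal_exp_add_single a t j u hunit, dotProduct_add,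
        dotProduct_single, neg_add, Real.exp_add, ← hQ, mul_assoc (Real.exp u - 1), ← hr] at h
      have h' : (Q.det * Real.exp (-((fun j => 1 / p j) ⬝ᵥ t))) * 1 ≤
          (Q.det * Real.exp (-((fun j => 1 / p j) ⬝ᵥ t))) *
            ((1 + (Real.exp u - 1) * r) * Real.exp (-(1 / p j * u))) := by
        linarith
      simpa using le_of_mul_le_mul_left h' (mul_pos hdet (Real.exp_pos _))
    exact sub_eq_zero.1 (hmin.hasDerivAt_eq_zero hderiv)
  have hq' : ∀ j, quadForm Q⁻¹ (a j) = 1 / p j / Real.exp (t j) := fun j => by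
    rw [← hq j, mul_div_cancel_left₀ _ (Real.exp_pos _).ne']
  have hgram : youngGram a p Q⁻¹ = Q := by
    rw [youngGram, hQ]
    congr 3
    ext j
    rw [← hQ, hq' j]
    have := (hp j).ne'
    field_simp
  refine ⟨Q⁻¹, fun j => ?_, ?_, ?_⟩
  · rw [hq' j]
    have := hp j
    positivity
  · rw [hgram]
    exact (Matrix.isUnit_iff_isUnit_det Q).2 hunit
  · rw [hgram]

/-! ### Calculus of the Young function -/

theorem interior_orthant (n : ℕ) : interior (orthant n) = {y | ∀ j, 0 < y j} := by
  have h : orthant n = Set.univ.pi fun _ => Set.Ici (0 : ℝ) := by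
    ext y; simp [orthant, Pi.le_def]
  rw [h, interior_pi_set Set.finite_univ]
  ext y
  simp

theorem continuous_youngFunction {n : ℕ} {p : Fin n → ℝ} (hp : ∀ j, 0 < p j) :
    Continuous (youngFunction p) :=
  continuous_finsetProd _ fun j _ =>
    (continuous_apply j).rpow_const fun _ => Or.inr (one_div_pos.2 (hp j)).le

theorem contDiffOn_youngFunction {n : ℕ} (p : Fin n → ℝ) :
    ContDiffOn ℝ 2 (youngFunction p) (interior (orthant n)) := by
  rw [interior_orthant]
  exact contDiffOn_prod fun j _ => (contDiff_apply ℝ ℝ j).contDiffOn.rpow_const_of_ne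
    fun y hy => (hy j).ne'

theorem youngFunction_pos {n : ℕ} (p : Fin n → ℝ) {y : Fin n → ℝ} (hy : ∀ j, 0 < y j) :
    0 < youngFunction p y :=
  Finset.prod_pos fun j _ => Real.rpow_pos_of_pos (hy j) _

theorem hasFDerivAt_youngFunction {n : ℕ} (p : Fin n → ℝ) {y : Fin n → ℝ} (hy : ∀ j, 0 < y j) :
    HasFDerivAt (youngFunction p) (youngFunction p y •
      ∑ j, (1 / p j / y j) • ContinuousLinearMap.proj (R := ℝ) (φ := fun _ : Fin n => ℝ) j) y := by
  have hexp : ∀ z : Fin n → ℝ, (∀ j, 0 < z j) →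
      youngFunction p z = Real.exp (∑ j, 1 / p j * Real.log (z j)) := fun z hz => by
    rw [Real.exp_sum]
    exact Finset.prod_congr rfl fun j _ => by rw [Real.rpow_def_of_pos (hz j), mul_comm]
  have h1 : HasFDerivAt (fun z : Fin n → ℝ => Real.exp (∑ j, 1 / p j * Real.log (z j)))
      (Real.exp (∑ j, 1 / p j * Real.log (y j)) • ∑ j, (1 / p j) • (y j)⁻¹ •
        ContinuousLinearMap.proj (R := ℝ) (φ := fun _ : Fin n => ℝ) j) y :=
    (HasFDerivAt.fun_sum fun j _ =>
      (((hasFDerivAt_apply j y).log (hy j).ne').const_mul (1 / p j))).exp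
  rw [← hexp y hy] at h1
  simp only [smul_smul, ← div_eq_mul_inv (1 / p _)] at h1
  refine h1.congr_of_eventuallyEq ?_
  have hopen : interior (orthant n) ∈ nhds y :=
    isOpen_interior.mem_nhds (by rw [interior_orthant]; exact hy)
  rw [interior_orthant] at hopen
  filter_upwards [hopen] with z hz using hexp z hz

theorem fderiv_youngFunction_single {n : ℕ} (p : Fin n → ℝ) {y : Fin n → ℝ} (hy : ∀ j, 0 < y j)
    (j : Fin n) :
    fderiv ℝ (youngFunction p) y (Pi.single j 1) = youngFunction p y * (1 / p j / y j) := by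
  rw [(hasFDerivAt_youngFunction p hy).fderiv]
  simp [Pi.single_apply]

theorem hess_youngFunction {n : ℕ} (p : Fin n → ℝ) {y : Fin n → ℝ} (hy : ∀ j, 0 < y j)
    (i j : Fin n) :
    hess (youngFunction p) y i j = youngFunction p y *
      (1 / p i / y i * (1 / p j / y j) - if i = j then 1 / p i / y i ^ 2 else 0) := by
  have hopen : interior (orthant n) ∈ nhds y :=
    isOpen_interior.mem_nhds (by rw [interior_orthant]; exact hy)
  rw [interior_orthant] at hopen
  have hev : (fun z => fderiv ℝ (youngFunction p) z (Pi.single j 1)) =ᶠ[nhds y]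
      fun z => youngFunction p z * (1 / p j * (z j)⁻¹) := by
    filter_upwards [hopen] with z hz
    rw [fderiv_youngFunction_single p hz, div_eq_mul_inv (1 / p j)]
  have hinv : HasFDerivAt (fun z : Fin n → ℝ => 1 / p j * (z j)⁻¹)
      ((1 / p j) • (-(y j ^ 2)⁻¹) •
        ContinuousLinearMap.proj (R := ℝ) (φ := fun _ : Fin n => ℝ) j) y :=
    (((hasDerivAt_inv (hy j).ne').comp_hasFDerivAt y (hasFDerivAt_apply j y))).const_mul (1 / p j)
  change fderiv ℝ (fun z => fderiv ℝ (youngFunction p) z (Pi.single j 1)) y (Pi.single i 1) = _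
  rw [hev.fderiv_eq, HasFDerivAt.fderiv ((hasFDerivAt_youngFunction p hy).fun_mul hinv)]
  have hyi := (hy i).ne'
  by_cases h : i = j
  · subst h
    simp [Pi.single_apply]
    ring
  · have h' : ¬ j = i := fun e => h e.symm
    simp [Pi.single_apply, h, h']
    ring

/-! ### The L3 inequality as a matrix inequality -/

theorem gram_apply {n k : ℕ} (a : Fin n → Fin k → ℝ) (C : Matrix (Fin k) (Fin k) ℝ)
    (j : Fin n) : ((colMatrix a)ᵀ * C * colMatrix a) j j = quadForm C (a j) := by
  rw [Matrix.mul_assoc, Matrix.mul_apply, quadForm, dotProduct_comm]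
  rfl

theorem scaledGram_eq {n k : ℕ} (a : Fin n → Fin k → ℝ) (p : Fin n → ℝ)
    (C : Matrix (Fin k) (Fin k) ℝ) :
    scaledGram a p C = scaling a p C * ((colMatrix a)ᵀ * C * colMatrix a) * scaling a p C := by
  have h : (scaling a p C)ᵀ = scaling a p C := Matrix.diagonal_transpose _
  simp only [scaledGram, Matrix.transpose_mul, h, Matrix.mul_assoc]

theorem hadamardHessNonpos_youngFunction_iff {n k : ℕ} {a : Fin n → Fin k → ℝ} {p : Fin n → ℝ}
    (hp : ∀ j, 0 < p j) {C : Matrix (Fin k) (Fin k) ℝ} (hC : ∀ j, 0 < quadForm C (a j))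
    {y : Fin n → ℝ} (hy : y ∈ interior (orthant n)) :
    HadamardHessNonpos a (youngFunction p) C y ↔ (1 - scaledGram a p C).PosSemidef := by
  rw [interior_orthant] at hy
  have hy : ∀ j, 0 < y j := hy
  set b := youngFunction p y with hb
  have hb0 : 0 < b := youngFunction_pos p hy
  -- Chosen so that `u j ^ 2` is the diagonal part of the negated Hadamard product, coming from the
  -- diagonal term of the Hessian; the rank-one term then becomes the conjugate of `scaledGram`.
  let u : Fin n → ℝ := fun j => √b * √(quadForm C (a j) / p j) / y j
  have hu : ∀ j, 0 < u j := fun j =>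
    div_pos (mul_pos (Real.sqrt_pos.2 hb0) (Real.sqrt_pos.2 (div_pos (hC j) (hp j)))) (hy j)
  have hu2 : ∀ j, u j * u j = b * (quadForm C (a j) / p j) / y j ^ 2 := fun j => by
    rw [← pow_two, div_pow, mul_pow, Real.sq_sqrt hb0.le, Real.sq_sqrt (div_pos (hC j) (hp j)).le]
  have hus : ∀ j, u j * √(1 / (p j * quadForm C (a j))) = √b * (1 / p j / y j) := fun j => by
    have h1 : √(quadForm C (a j) / p j) * √(1 / (p j * quadForm C (a j))) = 1 / p j := by
      rw [← Real.sqrt_mul (div_pos (hC j) (hp j)).le,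
        show quadForm C (a j) / p j * (1 / (p j * quadForm C (a j))) = (1 / p j) ^ 2 by
          have := (hC j).ne'
          field_simp,
        Real.sqrt_sq (one_div_pos.2 (hp j)).le]
    rw [← h1]
    ring
  have key : -(((colMatrix a)ᵀ * C * colMatrix a) ⊙ hess (youngFunction p) y) =
      star (Matrix.diagonal u) * (1 - scaledGram a p C) * Matrix.diagonal u := by
    rw [Matrix.star_eq_conjTranspose, Matrix.diagonal_conjTranspose, star_trivial, scaledGram_eq]
    ext i j
    rw [Matrix.mul_diagonal, Matrix.diagonal_mul, Matrix.neg_apply, Matrix.hadamard_apply,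
      hess_youngFunction p hy, Matrix.sub_apply, scaling, Matrix.mul_diagonal,
      Matrix.diagonal_mul, ← hb]
    set G := (colMatrix a)ᵀ * C * colMatrix a with hG
    have hprod : u i * (√(1 / (p i * quadForm C (a i))) * G i j *
        √(1 / (p j * quadForm C (a j)))) * u j =
        b * (G i j * (1 / p i / y i * (1 / p j / y j))) := by
      calc _ = (u i * √(1 / (p i * quadForm C (a i)))) * (u j * √(1 / (p j * quadForm C (a j)))) *
            G i j := by ring
        _ = (√b * √b) * (G i j * (1 / p i / y i * (1 / p j / y j))) := by
            rw [hus, hus]; ring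
        _ = _ := by rw [Real.mul_self_sqrt hb0.le]
    rw [mul_sub (u i), sub_mul _ _ (u j), hprod]
    by_cases h : i = j
    · subst h
      rw [if_pos rfl, Matrix.one_apply_eq, mul_one, hu2, hG, gram_apply]
      ring
    · rw [if_neg h, Matrix.one_apply_ne h]
      ring
  rw [HadamardHessNonpos, key]
  refine Matrix.IsUnit.posSemidef_star_left_conjugate_iff ?_
  rw [Matrix.isUnit_iff_isUnit_det, Matrix.det_diagonal, isUnit_iff_ne_zero]
  exact (Finset.prod_pos fun j _ => hu j).ne'

theorem scaling_mul_self {n k : ℕ} {a : Fin n → Fin k → ℝ} {p : Fin n → ℝ} (hp : ∀ j, 0 < p j)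
    {C : Matrix (Fin k) (Fin k) ℝ} (hC : ∀ j, 0 < quadForm C (a j)) :
    scaling a p C * scaling a p C = Matrix.diagonal fun j => 1 / (p j * quadForm C (a j)) := by
  rw [scaling, Matrix.diagonal_mul_diagonal]
  exact congrArg _ (funext fun j =>
    Real.mul_self_sqrt (one_div_pos.2 (mul_pos (hp j) (hC j))).le)

/-! ### Orthogonal projection and L3 -/

theorem IsYoungMatrix.isSymm {n k : ℕ} {a : Fin n → Fin k → ℝ} {p : Fin n → ℝ}
    {C : Matrix (Fin k) (Fin k) ℝ} (hC : IsYoungMatrix a p C) : C.IsSymm := by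
  rw [hC.2.2, Matrix.IsSymm, Matrix.transpose_nonsing_inv]
  congr 1
  simp only [youngGram, Matrix.transpose_mul, Matrix.transpose_transpose,
    Matrix.diagonal_transpose, Matrix.mul_assoc]

theorem IsYoungMatrix.isOrthogonalProjectionOnto {n k : ℕ} {a : Fin n → Fin k → ℝ}
    {p : Fin n → ℝ} (hp : ∀ j, 0 < p j) {C : Matrix (Fin k) (Fin k) ℝ}
    (hC : IsYoungMatrix a p C) :
    IsOrthogonalProjectionOnto (scaledGram a p C)
      (Submodule.span ℝ (Set.range (scaling a p C * (colMatrix a)ᵀ).col)) := by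
  -- With X = AS, the equation for C says C X X* = 1, so X*CX fixes the columns of X*; its range
  -- lies in their span by factorisation.
  have hfix : scaledGram a p C * (scaling a p C * (colMatrix a)ᵀ) =
      scaling a p C * (colMatrix a)ᵀ := by
    have hinv : C * youngGram a p C = 1 := by
      conv_lhs => arg 1; rw [hC.2.2]
      exact Matrix.nonsing_inv_mul _ ((Matrix.isUnit_iff_isUnit_det _).1 hC.2.1)
    calc scaledGram a p C * (scaling a p C * (colMatrix a)ᵀ)
        = scaling a p C * (colMatrix a)ᵀ *
            (C * (colMatrix a * (scaling a p C * scaling a p C) * (colMatrix a)ᵀ)) := by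
          rw [scaledGram_eq]; simp only [Matrix.mul_assoc]
      _ = _ := by
          rw [scaling_mul_self hp hC.1]
          rw [← youngGram, hinv, Matrix.mul_one]
  have hfac : scaledGram a p C =
      scaling a p C * (colMatrix a)ᵀ * (C * colMatrix a * scaling a p C) := by
    rw [scaledGram_eq]; simp only [Matrix.mul_assoc]
  refine ⟨?_, ?_, ?_⟩
  · simp only [Matrix.IsSymm, scaledGram, Matrix.transpose_mul, Matrix.transpose_transpose,
      hC.isSymm.eq, Matrix.mul_assoc]
  · conv_lhs => arg 2; rw [hfac]
    rw [← Matrix.mul_assoc, hfix, ← hfac]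
  · rw [← Matrix.range_mulVecLin]
    apply le_antisymm
    · rw [hfac, Matrix.mulVecLin_mul]
      exact LinearMap.range_comp_le_range _ _
    · conv_lhs => rw [← hfix, Matrix.mulVecLin_mul]
      exact LinearMap.range_comp_le_range _ _

theorem IsOrthogonalProjectionOnto.posSemidef_one_sub {n : ℕ} {P : Matrix (Fin n) (Fin n) ℝ}
    {V : Submodule ℝ (Fin n → ℝ)} (hP : IsOrthogonalProjectionOnto P V) :
    (1 - P).PosSemidef := by
  have h : (1 - P)ᴴ * (1 - P) = 1 - P := by
    rw [Matrix.conjTranspose_eq_transpose_of_trivial, Matrix.transpose_sub,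
      Matrix.transpose_one, hP.1.eq, Matrix.sub_mul, Matrix.mul_sub, Matrix.one_mul,
      Matrix.one_mul, Matrix.mul_sub, Matrix.mul_one, hP.2.1, sub_self, sub_zero]
  rw [← h]
  exact Matrix.posSemidef_conjTranspose_mul_self _

theorem IsYoungMatrix.isL3Matrix {n k : ℕ} {a : Fin n → Fin k → ℝ} {p : Fin n → ℝ}
    (hp : ∀ j, 0 < p j) {C : Matrix (Fin k) (Fin k) ℝ} (hC : IsYoungMatrix a p C) :
    IsL3Matrix a (youngFunction p) C :=
  ⟨hC.isSymm, fun _ hy => (hadamardHessNonpos_youngFunction_iff hp hC.1 hy).2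
    (hC.isOrthogonalProjectionOnto hp).posSemidef_one_sub, hC.1⟩

/-! ### Homogeneity and the Gaussian integral -/

theorem youngFunction_smul {n k : ℕ} {p : Fin n → ℝ} (hp : ∀ j, 0 < p j)
    (hsum : ∑ j, 1 / p j = (k : ℝ)) : L2 k (youngFunction p) := fun t ht y hy => by
  simp only [youngFunction, Pi.smul_apply, smul_eq_mul]
  rw [Finset.prod_congr rfl fun j _ => Real.mul_rpow ht (hy j), Finset.prod_mul_distrib,
    ← Real.rpow_sum_of_nonneg ht fun j _ => (one_div_pos.2 (hp j)).le, hsum, Real.rpow_natCast]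

/-- The Gaussian integral in L5 is finite as soon as the vectors contain a basis. -/
theorem integrable_youngFunction_gaussian {n k : ℕ} {a : Fin n → Fin k → ℝ} {p : Fin n → ℝ}
    (hp : ∀ j, 0 < p j) {f : Fin k → Fin n} (hf : LinearIndependent ℝ fun i => a (f i)) :
    L5 a (youngFunction p) := by
  classical
  set M : Matrix (Fin k) (Fin k) ℝ := Matrix.of fun i => a (f i) with hM
  have hdet : M.det ≠ 0 := (det_ne_zero_iff_linearIndependent a f).2 hf
  -- Factors of the integrand outside the basis are at most 1. The remaining product is a Gaussian
  -- in the coordinates ⟨a_{f(i)}, x⟩, reached by the invertible linear change of variables `M`.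
  have hG : MeasureTheory.Integrable
      (fun x : Fin k → ℝ => ∏ i, Real.exp (-(1 / p (f i)) * x i ^ 2)) :=
    MeasureTheory.Integrable.fintype_prod (f := fun i x => Real.exp (-(1 / p (f i)) * x ^ 2))
      fun i => integrable_exp_neg_mul_sq (one_div_pos.2 (hp (f i)))
  have hmap := Real.map_matrix_volume_pi_eq_smul_volume_pi hdet
  have hGM : MeasureTheory.Integrable
      (fun x : Fin k → ℝ => ∏ i, Real.exp (-(1 / p (f i)) * (a (f i) ⬝ᵥ x) ^ 2)) := by
    have h1 := hG.smul_measure (c := ENNReal.ofReal |M.det⁻¹|) ENNReal.ofReal_ne_top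
    rw [← hmap] at h1
    exact h1.comp_measurable (LinearMap.continuous_of_finiteDimensional _).measurable
  have hval : ∀ x : Fin k → ℝ, youngFunction p (fun j => Real.exp (-(a j ⬝ᵥ x) ^ 2)) =
      ∏ j, Real.exp (-(1 / p j) * (a j ⬝ᵥ x) ^ 2) := fun x =>
    Finset.prod_congr rfl fun j _ => by
      rw [← Real.exp_mul]
      ring_nf
  have hcont : Continuous fun x : Fin k → ℝ =>
      youngFunction p fun j => Real.exp (-(a j ⬝ᵥ x) ^ 2) :=
    (continuous_youngFunction hp).comp (continuous_pi fun j => by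
      simp only [dotProduct]
      fun_prop)
  refine hGM.mono' hcont.aestronglyMeasurable (Filter.Eventually.of_forall fun x => ?_)
  rw [Real.norm_of_nonneg (youngFunction_pos p fun j => Real.exp_pos _).le, hval,
    ← Finset.prod_image (s := Finset.univ) (g := f)
      (f := fun j => Real.exp (-(1 / p j) * (a j ⬝ᵥ x) ^ 2))
      fun i _ l _ h => hf.injective (congrArg a h)]
  refine Finset.prod_le_prod_of_subset_of_le_one (Finset.subset_univ _)
    (fun j _ => (Real.exp_pos _).le) fun j _ _ => Real.exp_le_one_iff.2 ?_
  have := one_div_pos.2 (hp j)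
  nlinarith [mul_nonneg this.le (sq_nonneg (a j ⬝ᵥ x))]

end BrascampLieb

theorem mainTheorem8 {n k : ℕ} (hk : 1 ≤ k) (hkn : k ≤ n)
    (a : Fin n → Fin k → ℝ) (p : Fin n → ℝ)
    (hp : ∀ j, 1 ≤ p j) (hsum : ∑ j, 1 / p j = (k : ℝ))
    (hK : (fun j => 1 / p j) ∈ intrinsicInterior ℝ (BrascampLieb.barthePolytope a)) :
    -- the matrix `C` exists
    (∃ C : Matrix (Fin k) (Fin k) ℝ, BrascampLieb.IsYoungMatrix a p C) ∧
    -- every such matrix is a witness for L3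
    (∀ C : Matrix (Fin k) (Fin k) ℝ, BrascampLieb.IsYoungMatrix a p C →
      BrascampLieb.IsL3Matrix a (BrascampLieb.youngFunction p) C) ∧
    -- the inequality in L3 is equivalent to `(A S)* C (A S) ≤ I`
    (∀ C : Matrix (Fin k) (Fin k) ℝ, C.IsSymm → (∀ j, 0 < BrascampLieb.quadForm C (a j)) →
      ∀ y ∈ interior (BrascampLieb.orthant n),
        (BrascampLieb.HadamardHessNonpos a (BrascampLieb.youngFunction p) C y ↔
          (1 - BrascampLieb.scaledGram a p C).PosSemidef)) ∧
    -- `(A S)* C (A S)` is the orthogonal projection onto the span of the columns of `S A*`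
    (∀ C : Matrix (Fin k) (Fin k) ℝ, BrascampLieb.IsYoungMatrix a p C →
      BrascampLieb.IsOrthogonalProjectionOnto (BrascampLieb.scaledGram a p C)
        (Submodule.span ℝ (Set.range
          (BrascampLieb.scaling a p C * (BrascampLieb.colMatrix a)ᵀ).col))) ∧
    -- the Young function satisfies L1–L5
    BrascampLieb.L1 (BrascampLieb.youngFunction p) ∧
    BrascampLieb.L2 k (BrascampLieb.youngFunction p) ∧
    BrascampLieb.L3 a (BrascampLieb.youngFunction p) ∧
    BrascampLieb.L4 (BrascampLieb.youngFunction p) ∧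
    BrascampLieb.L5 a (BrascampLieb.youngFunction p) := by

  have hp0 : ∀ j, 0 < p j := fun j => zero_lt_one.trans_le (hp j)
  obtain ⟨f, hf⟩ := BrascampLieb.exists_linearIndependent_of_mem_intrinsicInterior hK
  obtain ⟨C, hC⟩ := BrascampLieb.exists_isYoungMatrix hp0 hK
  exact ⟨⟨C, hC⟩, fun _ hC => hC.isL3Matrix hp0,
    fun _ _ hC _ hy => BrascampLieb.hadamardHessNonpos_youngFunction_iff hp0 hC hy,
    fun _ hC => hC.isOrthogonalProjectionOnto hp0,
    ⟨(BrascampLieb.continuous_youngFunction hp0).continuousOn,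
      BrascampLieb.contDiffOn_youngFunction p⟩,
    BrascampLieb.youngFunction_smul hp0 hsum, ⟨C, hC.isL3Matrix hp0⟩,
    ⟨fun _ hy => Finset.prod_nonneg fun j _ => Real.rpow_nonneg (hy j) _, 1,
      fun _ => zero_le_one, (BrascampLieb.youngFunction_pos p fun _ => zero_lt_one).ne'⟩,
    BrascampLieb.integrable_youngFunction_gaussian hp0 hf⟩
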